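/- Let $n,m\ge 0$, let $F=(f_{ij})\in\mathbb{Z}[x]^{n\times m}$, and let $d=\deg(F)$ be the maximal degree of the entries of $F$. Let $\mathrm{Sol}_{\mathbb{Z}[x]}(F)=\{y\in\mathbb{Z}[x]^m \mid Fy=0\}$, a $\mathbb{Z}[x]$-submodule of $\mathbb{Z}[x]^m$. Then $\mathrm{Sol}_{\mathbb{Z}[x]}(F)$ is generated as a $\mathbb{Z}[x]$-module by a finite set of vectors of degree $\le nd$. Moreover, if $F$ has rank $r$ (equivalently, rank $r$ over the field $\mathbb{Q}(x)$), then $\mathrm{Sol}_{\mathbb{Z}[x]}(F)$ is generated as a $\mathbb{Z}[x]$-module by a finite set of vectors of degree $\le rd$. Here the degree of a vector is the maximal degree of its entries, and the zero polynomial, as well as an empty matrix or vector, is given degree $0$. -/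

import Mathlib

open Polynomial

/-- The degree of a polynomial vector: the maximum of the degrees of its entries
(with the convention that the zero polynomial has degree `0`). -/
def polyVecDegree {R : Type*} [CommRing R] {m : ℕ} (y : Fin m → R[X]) : ℕ :=
  Finset.univ.sup fun j => (y j).natDegree

/-- The degree of a polynomial matrix: the maximum of the degrees of its entries
(with the convention that the zero polynomial has degree `0`). -/
def polyMatrixDegree {R : Type*} [CommRing R] {n m : ℕ}
    (F : Matrix (Fin n) (Fin m) R[X]) : ℕ :=
  Finset.univ.sup fun i => polyVecDegree (F i)

/-- The module of solutions `y` in `R[X]^m` of the homogeneous linear system `F y = 0`. -/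
noncomputable def solModule {R : Type*} [CommRing R] {n m : ℕ}
    (F : Matrix (Fin n) (Fin m) R[X]) : Submodule R[X] (Fin m → R[X]) :=
  LinearMap.ker F.mulVecLin

theorem mem_solModule {R : Type*} [CommRing R] {n m : ℕ}
    (F : Matrix (Fin n) (Fin m) R[X]) (y : Fin m → R[X]) :
    y ∈ solModule F ↔ F.mulVec y = 0 := by
  simp [solModule]

/-! Let `r` be the rank of `F`, `d` its degree and `e = r * d`. The solutions of degree `< k` form a
ℤ-module of finite rank `h k`. Since `Sol_(k+1) ∩ X Sol_(k+1) = X Sol_k`, the sequence `h` is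
convex. Rank-nullity gives `(m - r) k - e ≤ h k ≤ (m - r) k + C`, so the increments of `h` equal `m
- r` from index `e` on. Over a field this would already yield `Sol_(k+2) = Sol_(k+1) + X Sol_(k+1)`
for `k ≥ e`, by equality of dimensions.

Over ℤ equal ranks do not suffice, so one reduces modulo every prime `p`. Purity preserves the
ranks, but the images `V k` need not satisfy the intersection identity. Their saturation `W` does,
and it agrees with `V` for large `k`. The same bounds force `W` and `V` to have equal increments
from `e` on, hence `V = W` there (`le_sup_map_of_finrank`). The identity modulo every `p` lifts to ℤ
by Nakayama (`le_of_le_sup_smul_prime`). -/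

/-! ### Convex integer sequences. -/

/-- A convex integer sequence which stays below the line `s * k + C` has increments at most `s`. -/
theorem increment_le_of_convex {f : ℕ → ℤ} (hconv : ∀ k, 2 * f (k + 1) ≤ f (k + 2) + f k)
    {s C : ℤ} {k₁ : ℕ} (hub : ∀ k, k₁ ≤ k → f k ≤ s * k + C) (k : ℕ) : f (k + 1) - f k ≤ s := by
  by_contra! h
  have hinc : ∀ j, s + 1 ≤ f (k + j + 1) - f (k + j) := by
    intro j
    induction j with
    | zero => simpa using h
    | succ j ih => have := hconv (k + j); simp only [← add_assoc] at *; linarith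
  have hgrow : ∀ j : ℕ, f k + (s + 1) * j ≤ f (k + j) := by
    intro j
    induction j with
    | zero => simp
    | succ j ih => have := hinc j; push_cast; rw [← add_assoc]; linarith
  obtain ⟨j, hj⟩ := exists_nat_gt (s * k + C - f k)
  have h1 := hgrow (j + k₁)
  have h2 := hub (k + (j + k₁)) (by omega)
  push_cast at h1 h2
  nlinarith

theorem increment_mono_of_convex {f : ℕ → ℤ} (hconv : ∀ k, 2 * f (k + 1) ≤ f (k + 2) + f k) :
    Monotone fun k => f (k + 1) - f k :=
  monotone_nat_of_le_succ fun k => by have := hconv k; simp only [add_assoc] at *; norm_num; linarith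

/-- A convex integer sequence starting at `0` and bounded below by `s * k - e` has increments at
least `s` from index `e` on. -/
theorem le_increment_of_convex {f : ℕ → ℤ} (hconv : ∀ k, 2 * f (k + 1) ≤ f (k + 2) + f k)
    (h0 : f 0 = 0) {s : ℤ} {e : ℕ} (hlb : ∀ k : ℕ, s * k - e ≤ f k) {k : ℕ} (hk : e ≤ k) :
    s ≤ f (k + 1) - f k := by
  by_contra! h
  have hinc : ∀ j, j ≤ k → f (j + 1) - f j ≤ s - 1 := fun j hj => by
    have := increment_mono_of_convex hconv hj
    simp only at this
    linarith
  have hgrow : ∀ j : ℕ, j ≤ k + 1 → f j ≤ (s - 1) * j := by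
    intro j
    induction j with
    | zero => simp [h0]
    | succ j ih =>
      intro hj
      have := hinc j (by omega)
      have := ih (by omega)
      push_cast
      linarith
  have h1 := hgrow (k + 1) le_rfl
  have h2 := hlb (k + 1)
  push_cast at h1 h2
  have : (e : ℤ) ≤ k := by exact_mod_cast hk
  linarith

/-- A convex integer sequence of at most linear growth eventually has constant increments. -/
theorem exists_increment_eq_of_convex {f : ℕ → ℤ} (hconv : ∀ k, 2 * f (k + 1) ≤ f (k + 2) + f k)
    {s C : ℤ} {k₁ : ℕ} (hub : ∀ k, k₁ ≤ k → f k ≤ s * k + C) :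
    ∃ k₀, ∀ k, k₀ ≤ k → f (k + 2) + f k = 2 * f (k + 1) := by
  -- The increments are monotone integers bounded above, so they are constant once their greatest
  -- value is attained.
  obtain ⟨c, ⟨k₀, hk₀⟩, hc⟩ := Int.exists_greatest_of_bdd
    (P := fun c => ∃ k, f (k + 1) - f k = c)
    ⟨s, fun z ⟨k, hk⟩ => hk ▸ increment_le_of_convex hconv hub k⟩ ⟨_, 0, rfl⟩
  refine ⟨k₀, fun k hk => ?_⟩
  have h1 : c ≤ f (k + 1) - f k := hk₀ ▸ increment_mono_of_convex hconv hk
  have h2 := hc _ ⟨k + 1, rfl⟩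
  have h3 := hconv k
  simp only [add_assoc] at *
  norm_num at *
  linarith

/-! ### Dimension convexity of saturated filtrations. -/

section Filtration

variable {K E : Type*} [CommRing K] [IsDomain K] [AddCommGroup E] [Module K E]
  {T : E →ₗ[K] E} {W : ℕ → Submodule K E}

/-- Inclusion-exclusion: `hsat` makes `W (k + 1) ⊓ T (W (k + 1))` exactly `T (W k)`. -/
theorem finrank_sup_map_add_finrank [∀ k, Module.Finite K (W k)] (hT : Function.Injective T)
    (hmono : ∀ k, W k ≤ W (k + 1)) (hshift : ∀ k, ∀ w ∈ W k, T w ∈ W (k + 1))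
    (hsat : ∀ k, ∀ w ∈ W (k + 1), T w ∈ W (k + 1) → w ∈ W k) (k : ℕ) :
    Module.finrank K ↥(W (k + 1) ⊔ (W (k + 1)).map T) + Module.finrank K (W k) =
      2 * Module.finrank K (W (k + 1)) := by
  have hinf : W (k + 1) ⊓ (W (k + 1)).map T = (W k).map T := by
    ext x
    constructor
    · rintro ⟨hx, w, hw, rfl⟩
      exact ⟨w, hsat k w hw hx, rfl⟩
    · rintro ⟨w, hw, rfl⟩
      exact ⟨hshift k w hw, w, hmono k hw, rfl⟩
  have hrank := Submodule.rank_sup_add_rank_inf_eq (W (k + 1)) ((W (k + 1)).map T)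
  have hfin : ∀ k, Module.finrank K ((W k).map T) = Module.finrank K (W k) := fun k =>
    (Submodule.equivMapOfInjective T hT (W k)).symm.finrank_eq
  rw [hinf, ← Module.finrank_eq_rank, ← Module.finrank_eq_rank, ← Module.finrank_eq_rank,
    ← Module.finrank_eq_rank, hfin, hfin] at hrank
  norm_cast at hrank
  omega

theorem two_mul_finrank_le [∀ k, Module.Finite K (W k)] (hT : Function.Injective T)
    (hmono : ∀ k, W k ≤ W (k + 1)) (hshift : ∀ k, ∀ w ∈ W k, T w ∈ W (k + 1))
    (hsat : ∀ k, ∀ w ∈ W (k + 1), T w ∈ W (k + 1) → w ∈ W k) (k : ℕ) :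
    2 * (Module.finrank K (W (k + 1)) : ℤ) ≤
      Module.finrank K (W (k + 2)) + Module.finrank K (W k) := by
  have h1 := finrank_sup_map_add_finrank hT hmono hshift hsat k
  have h2 : Module.finrank K ↥(W (k + 1) ⊔ (W (k + 1)).map T) ≤ Module.finrank K (W (k + 2)) :=
    Submodule.finrank_mono (sup_le (hmono _) (Submodule.map_le_iff_le_comap.2 (hshift (k + 1))))
  omega

end Filtration

/-! ### Saturation of a filtration. -/

section Saturation

variable {K E : Type*} [Field K] [AddCommGroup E] [Module K E]

/-- The saturation of a filtration `V` with respect to an endomorphism `T`, viewing the pair as a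
graded module over a polynomial ring in two variables. -/
def filtrationSaturation (T : E →ₗ[K] E) (V : ℕ → Submodule K E) (k : ℕ) :
    Submodule K E where
  carrier := {w | ∃ j, ∀ J, j ≤ J → ∀ i, i ≤ J → (T ^ i) w ∈ V (k + J)}
  add_mem' := by
    rintro a b ⟨j, hj⟩ ⟨j', hj'⟩
    refine ⟨max j j', fun J hJ i hi => ?_⟩
    rw [map_add]
    exact add_mem (hj J (le_trans (le_max_left _ _) hJ) i hi)
      (hj' J (le_trans (le_max_right _ _) hJ) i hi)
  zero_mem' := ⟨0, fun J _ i _ => by simp⟩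
  smul_mem' := by
    rintro c a ⟨j, hj⟩
    refine ⟨j, fun J hJ i hi => ?_⟩
    rw [map_smul]
    exact Submodule.smul_mem _ _ (hj J hJ i hi)

variable {T : E →ₗ[K] E} {V : ℕ → Submodule K E}

theorem mem_filtrationSaturation {k : ℕ} {w : E} :
    w ∈ filtrationSaturation T V k ↔
      ∃ j, ∀ J, j ≤ J → ∀ i, i ≤ J → (T ^ i) w ∈ V (k + J) := Iff.rfl

theorem le_filtrationSaturation (hmono : ∀ k, V k ≤ V (k + 1))
    (hshift : ∀ k, ∀ w ∈ V k, T w ∈ V (k + 1)) (k : ℕ) :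
    V k ≤ filtrationSaturation T V k := by
  intro w hw
  have hpow : ∀ i, (T ^ i) w ∈ V (k + i) := by
    intro i
    induction i with
    | zero => simpa using hw
    | succ i ih => rw [pow_succ', Module.End.mul_apply]; exact hshift _ _ ih
  exact ⟨0, fun J _ i hi => monotone_nat_of_le_succ hmono (by omega : k + i ≤ k + J) (hpow i)⟩

theorem filtrationSaturation_mono (hmono : ∀ k, V k ≤ V (k + 1)) (k : ℕ) :
    filtrationSaturation T V k ≤ filtrationSaturation T V (k + 1) := by
  rintro w ⟨j, hj⟩
  exact ⟨j, fun J hJ i hi => monotone_nat_of_le_succ hmono (by omega) (hj J hJ i hi)⟩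

theorem filtrationSaturation_shift (k : ℕ) (w : E) (hw : w ∈ filtrationSaturation T V k) :
    T w ∈ filtrationSaturation T V (k + 1) := by
  obtain ⟨j, hj⟩ := hw
  refine ⟨j, fun J hJ i hi => ?_⟩
  have := hj (J + 1) (by omega) (i + 1) (by omega)
  rwa [pow_succ, Module.End.mul_apply, show k + (J + 1) = k + 1 + J by ring] at this

/-- A monomial of degree `J + 1` in the two variables is divisible by one of them: powers `T ^ (i +
1)` are handled by the condition on `T w`, and `i = 0` by that on `w`. -/
theorem filtrationSaturation_sat (k : ℕ) (w : E)
    (hw : w ∈ filtrationSaturation T V (k + 1))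
    (hTw : T w ∈ filtrationSaturation T V (k + 1)) :
    w ∈ filtrationSaturation T V k := by
  obtain ⟨j, hj⟩ := hw
  obtain ⟨j', hj'⟩ := hTw
  refine ⟨max j j' + 1, fun J hJ i hi => ?_⟩
  obtain ⟨J, rfl⟩ : ∃ J', J = J' + 1 := ⟨J - 1, by omega⟩
  rw [show k + (J + 1) = k + 1 + J by ring]
  rcases i with _ | i
  · exact hj J (by omega) 0 (by omega)
  · rw [pow_succ, Module.End.mul_apply]
    exact hj' J (by omega) i (by omega)

theorem filtrationSaturation_le {U : ℕ → Submodule K E} (hVU : ∀ k, V k ≤ U k)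
    (hU : ∀ k w, T w ∈ U (k + 1) → w ∈ U k) (k : ℕ) :
    filtrationSaturation T V k ≤ U k := by
  rintro w ⟨j, hj⟩
  have key : ∀ i, (T ^ i) w ∈ U (k + i) → w ∈ U k := by
    intro i
    induction i with
    | zero => simp
    | succ i ih => intro h; rw [pow_succ', Module.End.mul_apply] at h; exact ih (hU _ _ h)
  exact key j (hVU _ (hj j le_rfl j le_rfl))

/-- If the saturation is eventually generated by its previous steps, it eventually agrees with the
original filtration. -/
theorem exists_filtrationSaturation_le
    [∀ k, Module.Finite K (filtrationSaturation T V k)] {k₀ : ℕ}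
    (hgen : ∀ k, k₀ ≤ k → filtrationSaturation T V (k + 1) ≤
      filtrationSaturation T V k ⊔ (filtrationSaturation T V k).map T) :
    ∃ k₁, ∀ k, k₁ ≤ k → filtrationSaturation T V k ≤ V k := by
  -- The threshold depends on the vector; finite generation at level `k₀` makes it uniform.
  have huniform : ∃ j, ∀ w ∈ filtrationSaturation T V k₀,
      ∀ J, j ≤ J → ∀ i, i ≤ J → (T ^ i) w ∈ V (k₀ + J) := by
    obtain ⟨S, hS⟩ := Module.Finite.iff_fg.1
      (inferInstance : Module.Finite K (filtrationSaturation T V k₀))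
    have hmem : ∀ s ∈ S, ∃ j, ∀ J, j ≤ J → ∀ i, i ≤ J → (T ^ i) s ∈ V (k₀ + J) := fun s hs =>
      mem_filtrationSaturation.1 (hS ▸ Submodule.subset_span hs)
    choose! j hj using hmem
    refine ⟨S.sup j, fun w hw J hJ i hi => ?_⟩
    have hle : filtrationSaturation T V k₀ ≤ (V (k₀ + J)).comap (T ^ i) := by
      rw [← hS, Submodule.span_le]
      exact fun s hs => hj s hs J ((Finset.le_sup hs).trans hJ) i hi
    exact hle hw
  obtain ⟨j, hj⟩ := huniform
  -- Writing `w = u + T v` one level down trades one unit of `a` for one of `b`, so the threshold on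
  -- `a + b` is preserved.
  have key : ∀ a b, j ≤ a + b → ∀ w ∈ filtrationSaturation T V (k₀ + a), ∀ i, i ≤ b →
      (T ^ i) w ∈ V (k₀ + a + b) := by
    intro a
    induction a with
    | zero => intro b hb w hw i hi; exact hj w hw b (by simpa using hb) i hi
    | succ a ih =>
      intro b hb w hw i hi
      obtain ⟨u, hu, v', ⟨v, hv, rfl⟩, rfl⟩ := Submodule.mem_sup.1 (hgen (k₀ + a) (by omega) hw)
      have h1 := ih (b + 1) (by omega) u hu i (by omega)
      have h2 := ih (b + 1) (by omega) v hv (i + 1) (by omega)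
      rw [pow_succ, Module.End.mul_apply] at h2
      rw [map_add, show k₀ + (a + 1) + b = k₀ + a + (b + 1) by ring]
      exact add_mem h1 h2
  refine ⟨k₀ + j, fun k hk w hw => ?_⟩
  obtain ⟨a, rfl⟩ : ∃ a, k = k₀ + a := ⟨k - k₀, by omega⟩
  simpa using key a 0 (by omega) w hw 0 le_rfl

/-- A filtration whose dimensions form a convex sequence squeezed between `s * k - e` and
`s * k + C` is generated by its previous steps beyond index `e`. -/
theorem le_sup_map_of_finrank {U : ℕ → Submodule K E} [∀ k, Module.Finite K (U k)]
    (hT : Function.Injective T) (hmono : ∀ k, V k ≤ V (k + 1))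
    (hshift : ∀ k, ∀ w ∈ V k, T w ∈ V (k + 1)) (hVU : ∀ k, V k ≤ U k)
    (hU : ∀ k w, T w ∈ U (k + 1) → w ∈ U k) (hU0 : U 0 = ⊥) {m : ℕ}
    (hUm : ∀ k, Module.finrank K (U k) ≤ m * k)
    (hconv : ∀ k, 2 * (Module.finrank K (V (k + 1)) : ℤ) ≤
      Module.finrank K (V (k + 2)) + Module.finrank K (V k))
    {s C : ℤ} {e : ℕ} (hlb : ∀ k : ℕ, s * k - e ≤ Module.finrank K (V k))
    (hub : ∀ k : ℕ, Module.finrank K (V k) ≤ s * k + C) {k : ℕ} (hk : e ≤ k) :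
    V (k + 2) ≤ V (k + 1) ⊔ (V (k + 1)).map T := by
  set W := filtrationSaturation T V with hW
  have hWU : ∀ k, W k ≤ U k := filtrationSaturation_le hVU hU
  have hVW : ∀ k, V k ≤ W k := le_filtrationSaturation hmono hshift
  have hfinW : ∀ k, Module.Finite K (W k) := fun k => Submodule.finiteDimensional_of_le (hWU k)
  have hWmono : ∀ k, W k ≤ W (k + 1) := filtrationSaturation_mono hmono
  have hWshift : ∀ k, ∀ w ∈ W k, T w ∈ W (k + 1) := filtrationSaturation_shift
  have hWsat : ∀ k, ∀ w ∈ W (k + 1), T w ∈ W (k + 1) → w ∈ W k := filtrationSaturation_sat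
  have hWconv := two_mul_finrank_le hT hWmono hWshift hWsat
  -- This crude bound makes the increments of `W` stabilize before anything relates `W` to `V`.
  have hWle : ∀ k, Module.finrank K (W k) ≤ m * k := fun k =>
    (Submodule.finrank_mono (hWU k)).trans (hUm k)
  have hgen : ∀ k, ((Module.finrank K (W (k + 2)) : ℤ) + Module.finrank K (W k) =
      2 * Module.finrank K (W (k + 1))) → W (k + 2) = W (k + 1) ⊔ (W (k + 1)).map T := by
    intro k h
    refine (Submodule.eq_of_le_of_finrank_eq (sup_le (hWmono _)
      (Submodule.map_le_iff_le_comap.2 (hWshift (k + 1)))) ?_).symm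
    change _ = Module.finrank K (W (k + 2))
    have := finrank_sup_map_add_finrank hT hWmono hWshift hWsat k
    omega
  obtain ⟨k₀, hk₀⟩ := exists_increment_eq_of_convex (f := fun k => (Module.finrank K (W k) : ℤ))
    hWconv (s := m) (C := 0) (k₁ := 0) (fun k _ => by have := hWle k; norm_cast)
  obtain ⟨k₁, hk₁⟩ := exists_filtrationSaturation_le (T := T) (V := V)
    (k₀ := k₀ + 1) (fun k hk => by
      obtain ⟨k, rfl⟩ : ∃ k', k = k' + 1 := ⟨k - 1, by omega⟩
      exact (hgen k (hk₀ k (by omega))).le)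
  have hVWeq : ∀ k, k₁ ≤ k → W k = V k := fun k hk => le_antisymm (hk₁ k hk) (hVW k)
  have hV0 : Module.finrank K (V 0) = 0 := by
    rw [eq_bot_iff.2 ((hVU 0).trans hU0.le), finrank_bot]
  have hW0 : Module.finrank K (W 0) = 0 := by
    rw [eq_bot_iff.2 ((hWU 0).trans hU0.le), finrank_bot]
  have hVinc : ∀ k, e ≤ k →
      (Module.finrank K (V (k + 1)) : ℤ) - Module.finrank K (V k) = s := fun k hk =>
    le_antisymm (increment_le_of_convex (f := fun k => (Module.finrank K (V k) : ℤ)) hconv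
        (k₁ := 0) (fun k _ => hub k) k)
      (le_increment_of_convex (f := fun k => (Module.finrank K (V k) : ℤ)) hconv (by simp [hV0])
        hlb hk)
  have hWinc : ∀ k, e ≤ k →
      (Module.finrank K (W (k + 1)) : ℤ) - Module.finrank K (W k) = s := fun k hk =>
    le_antisymm (increment_le_of_convex (f := fun k => (Module.finrank K (W k) : ℤ)) hWconv
        (k₁ := k₁) (C := C) (fun k hk => by rw [hVWeq k hk]; exact hub k) k)
      (le_increment_of_convex (f := fun k => (Module.finrank K (W k) : ℤ)) hWconv (by simp [hW0])
        (fun k => (hlb k).trans (by exact_mod_cast Submodule.finrank_mono (hVW k))) hk)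
  -- The gap between `W` and `V` is constant from `e` on, and it vanishes at `e + k₁`.
  have hdiff : ∀ j, (Module.finrank K (W (e + j)) : ℤ) - Module.finrank K (V (e + j)) =
      Module.finrank K (W e) - Module.finrank K (V e) := by
    intro j
    induction j with
    | zero => simp
    | succ j ih =>
      have h1 := hVinc (e + j) (by omega)
      have h2 := hWinc (e + j) (by omega)
      rw [← add_assoc]
      linarith
  have heq : ∀ k, e ≤ k → V k = W k := by
    intro k hk
    refine Submodule.eq_of_le_of_finrank_eq (hVW k) ?_
    obtain ⟨j, rfl⟩ : ∃ j, k = e + j := ⟨k - e, by omega⟩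
    have h1 := hdiff j
    have h2 := hdiff k₁
    rw [hVWeq (e + k₁) (by omega)] at h2
    omega
  rw [heq (k + 2) (by omega), heq (k + 1) (by omega)]
  refine (hgen k ?_).le
  have h1 := hWinc k hk
  have h2 : (Module.finrank K (W (k + 2)) : ℤ) - Module.finrank K (W (k + 1)) = s :=
    hWinc (k + 1) (by omega)
  linarith

end Saturation

/-! ### Reduction modulo primes. -/

section Reduction

instance ringHomSurjective_castRingHom_zmod (p : ℕ) : RingHomSurjective (Int.castRingHom (ZMod p)) :=
  ⟨ZMod.ringHom_surjective _⟩

variable {p : ℕ} [Fact p.Prime] {E E' : Type*} [AddCommGroup E] [AddCommGroup E']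
  [Module (ZMod p) E'] {red : E →ₛₗ[Int.castRingHom (ZMod p)] E'}

/-- Reduction modulo `p` preserves the rank of a pure submodule. -/
theorem finrank_map_reduction [Module.IsTorsionFree ℤ E]
    (hker : ∀ x, red x = 0 → ∃ z, x = (p : ℤ) • z)
    (M : Submodule ℤ E) [Module.Finite ℤ M] (hpure : ∀ z, (p : ℤ) • z ∈ M → z ∈ M) :
    Module.finrank (ZMod p) (M.map red) = Module.finrank ℤ M := by
  have hp0 : (p : ℤ) ≠ 0 := by exact_mod_cast (Fact.out : p.Prime).ne_zero
  let b := Module.finBasis ℤ M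
  have hsum : ∀ c : Fin (Module.finrank ℤ M) → ℤ,
      red ((∑ i, c i • b i : M) : E) = ∑ i, (c i : ZMod p) • red (b i) := by
    intro c
    simp [map_sum]
  have hli : LinearIndependent (ZMod p) fun i => red (b i) := by
    rw [Fintype.linearIndependent_iff]
    intro g hg i
    choose c hc using fun i => ZMod.intCast_surjective (g i)
    have h0 : red ((∑ i, c i • b i : M) : E) = 0 := by rw [hsum]; simpa only [hc] using hg
    -- A relation modulo `p` lifts to an element of `p E`, hence of `p M` by purity, so its
    -- coordinates are divisible by `p`.
    obtain ⟨z, hz⟩ := hker _ h0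
    have hzM : z ∈ M := hpure z (hz ▸ (∑ i, c i • b i : M).2)
    have heq : (∑ i, c i • b i : M) = (p : ℤ) • ⟨z, hzM⟩ := Subtype.ext hz
    have := congrArg (fun x => b.repr x i) heq
    simp only [b.repr_sum_self, map_smul, Finsupp.smul_apply, smul_eq_mul] at this
    rw [← hc, this]
    simp
  have hspan : M.map red = Submodule.span (ZMod p) (Set.range fun i => red (b i)) := by
    apply le_antisymm
    · rintro _ ⟨x, hx, rfl⟩
      have hx' : x = ((∑ i, b.repr ⟨x, hx⟩ i • b i : M) : E) := by rw [b.sum_repr]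
      rw [hx', hsum]
      exact Submodule.sum_mem _ fun i _ => Submodule.smul_mem _ _ (Submodule.subset_span ⟨i, rfl⟩)
    · rw [Submodule.span_le]
      rintro _ ⟨i, rfl⟩
      exact ⟨b i, (b i).2, rfl⟩
  rw [hspan, finrank_span_eq_card hli, Fintype.card_fin]

/-- A finitely generated abelian group `B` with `B = A + p B` for all primes `p` equals `A`. -/
theorem le_of_le_sup_smul_prime {E : Type*} [AddCommGroup E] {A B : Submodule ℤ E}
    [Module.Finite ℤ B]
    (h : ∀ p : ℕ, p.Prime → ∀ b ∈ B, ∃ a ∈ A, ∃ z ∈ B, b = a + (p : ℤ) • z) : B ≤ A := by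
  let N := B.map A.mkQ
  have hN : N.FG := (Module.Finite.iff_fg.1 ‹_›).map _
  have hmul : ∀ p : ℕ, p.Prime → N ≤ Ideal.span {(p : ℤ)} • N := by
    rintro p hp _ ⟨b, hb, rfl⟩
    obtain ⟨a, ha, z, hz, rfl⟩ := h p hp b hb
    rw [map_add, map_smul, (Submodule.Quotient.mk_eq_zero A).2 ha |> (show A.mkQ a = 0 from ·),
      zero_add]
    exact Submodule.smul_mem_smul (Ideal.mem_span_singleton_self _) ⟨z, hz, rfl⟩
  -- A prime dividing the generator `a` would contradict Nakayama, which puts some `r ≡ 1` mod `p`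
  -- in the annihilator. So `a` is a unit and `N = 0`.
  obtain ⟨a, ha⟩ := (IsPrincipalIdealRing.principal (Module.annihilator ℤ N)).principal
  have hunit : a.natAbs = 1 := by
    by_contra hne
    obtain ⟨p, hp, hpa⟩ := Nat.exists_prime_and_dvd hne
    obtain ⟨r, hr, hrN⟩ := Submodule.exists_sub_one_mem_and_smul_eq_zero_of_fg_of_le_smul
      (Ideal.span {(p : ℤ)}) N hN (hmul p hp)
    have hrann : r ∈ Module.annihilator ℤ N := by
      rw [Module.mem_annihilator]
      exact fun n => Subtype.ext (hrN n n.2)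
    rw [ha] at hrann
    have h1 : (p : ℤ) ∣ r := (Int.natCast_dvd.2 hpa).trans (Ideal.mem_span_singleton.1 hrann)
    have h2 : (p : ℤ) ∣ r - 1 := Ideal.mem_span_singleton.1 hr
    have h3 : (p : ℤ) ∣ 1 := by simpa using dvd_sub h1 h2
    exact hp.one_lt.ne' (by exact_mod_cast Int.eq_one_of_dvd_one (by positivity) h3)
  have hone : (1 : ℤ) ∈ Module.annihilator ℤ N := by
    rw [ha]
    exact Ideal.mem_span_singleton.2 (Int.isUnit_iff_natAbs_eq.2 hunit).dvd
  intro b hb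
  have := Module.mem_annihilator.1 hone ⟨A.mkQ b, b, hb, rfl⟩
  rw [one_smul] at this
  exact (Submodule.Quotient.mk_eq_zero A).1 (congrArg Subtype.val this)

end Reduction

/-! ### Polynomial vectors of bounded degree. -/

section PolyVecLT

variable (R : Type*) [CommRing R] (m : ℕ)

/-- The polynomial vectors all of whose entries have degree less than `k`. -/
noncomputable def polyVecLT (k : ℕ) : Submodule R (Fin m → R[X]) :=
  Submodule.pi Set.univ fun _ => degreeLT R k

/-- Multiplication of polynomial vectors by the variable. -/
noncomputable def polyVecMulX : (Fin m → R[X]) →ₗ[R] (Fin m → R[X]) :=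
  (LinearMap.lsmul R[X] (Fin m → R[X]) X).restrictScalars R

variable {R m}

@[simp]
theorem polyVecMulX_apply (y : Fin m → R[X]) : polyVecMulX R m y = (X : R[X]) • y := rfl

theorem polyVecMulX_injective [IsDomain R] : Function.Injective (polyVecMulX R m) := fun _ _ h =>
  smul_right_injective _ (X_ne_zero (R := R)) h

theorem mem_polyVecLT {k : ℕ} {y : Fin m → R[X]} :
    y ∈ polyVecLT R m k ↔ ∀ j i, k ≤ i → (y j).coeff i = 0 := by
  simp [polyVecLT, Submodule.mem_pi, mem_degreeLT, degree_lt_iff_coeff_zero]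

theorem polyVecLT_mono {k l : ℕ} (h : k ≤ l) : polyVecLT R m k ≤ polyVecLT R m l :=
  fun _ hy => mem_polyVecLT.2 fun j i hi => mem_polyVecLT.1 hy j i (h.trans hi)

theorem polyVecLT_zero : polyVecLT R m 0 = ⊥ :=
  eq_bot_iff.2 fun _ hy => funext fun j => Polynomial.ext fun i =>
    mem_polyVecLT.1 hy j i (Nat.zero_le i)

theorem X_smul_mem_polyVecLT {k : ℕ} {y : Fin m → R[X]} :
    (X : R[X]) • y ∈ polyVecLT R m (k + 1) ↔ y ∈ polyVecLT R m k := by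
  simp only [mem_polyVecLT, Pi.smul_apply, smul_eq_mul]
  constructor
  · intro h j i hi
    simpa using h j (i + 1) (by omega)
  · intro h j i hi
    obtain ⟨i, rfl⟩ : ∃ i', i = i' + 1 := ⟨i - 1, by omega⟩
    simpa using h j i (by omega)

theorem polyVecDegree_le_of_mem {k : ℕ} {y : Fin m → R[X]} (hy : y ∈ polyVecLT R m (k + 1)) :
    polyVecDegree y ≤ k :=
  Finset.sup_le fun j _ => natDegree_le_iff_coeff_eq_zero.2 fun _ => mem_polyVecLT.1 hy j _

theorem mem_polyVecLT_of_polyVecDegree {k : ℕ} {y : Fin m → R[X]} (h : polyVecDegree y < k) :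
    y ∈ polyVecLT R m k :=
  mem_polyVecLT.2 fun j _ hi => coeff_eq_zero_of_natDegree_lt <|
    (Finset.le_sup (f := fun j => (y j).natDegree) (Finset.mem_univ j)).trans_lt (h.trans_le hi)

/-- Vectors of bounded degree correspond to tuples of polynomials of bounded degree. -/
noncomputable def polyVecLTEquiv (k : ℕ) : polyVecLT R m k ≃ₗ[R] (Fin m → degreeLT R k) where
  toFun y j := ⟨y.1 j, y.2 j trivial⟩
  invFun z := ⟨fun j => z j, fun j _ => (z j).2⟩
  map_add' _ _ := rfl
  map_smul' _ _ := rfl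
  left_inv _ := rfl
  right_inv _ := rfl

instance (k : ℕ) : Module.Finite R (polyVecLT R m k) :=
  Module.Finite.equiv (polyVecLTEquiv k).symm

theorem finrank_degreeLT [Nontrivial R] (k : ℕ) : Module.finrank R (degreeLT R k) = k := by
  simp [(degreeLTEquiv R k).finrank_eq]

theorem finrank_polyVecLT [Nontrivial R] (k : ℕ) :
    Module.finrank R (polyVecLT R m k) = m * k := by
  rw [(polyVecLTEquiv k).finrank_eq, Module.finrank_pi_fintype]
  simp [finrank_degreeLT]

theorem smul_mem_polyVecLT {k C : ℕ} {c : R[X]} {u : Fin m → R[X]} (hc : c ∈ degreeLT R k)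
    (hu : u ∈ polyVecLT R m C) : c • u ∈ polyVecLT R m (k + C) := by
  intro j _
  have h1 : (u j).degree < (C : ℕ) := mem_degreeLT.1 (hu j trivial)
  have h2 : c.degree < (k : ℕ) := mem_degreeLT.1 hc
  rw [SetLike.mem_coe, mem_degreeLT, Pi.smul_apply, smul_eq_mul]
  by_cases hc : c = 0
  · rw [hc, zero_mul, degree_zero]
    exact WithBot.bot_lt_coe _
  · calc (c * u j).degree ≤ c.degree + (u j).degree := degree_mul_le _ _
      _ < c.degree + (C : ℕ) := WithBot.add_lt_add_left (degree_ne_bot.2 hc) h1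
      _ ≤ (k : ℕ) + (C : ℕ) := by gcongr
      _ = ((k + C : ℕ) : WithBot ℕ) := by push_cast; rfl

theorem mulVec_mem_polyVecLT {n k : ℕ} (F : Matrix (Fin n) (Fin m) R[X]) {y : Fin m → R[X]}
    (hy : y ∈ polyVecLT R m k) : F.mulVec y ∈ polyVecLT R n (k + polyMatrixDegree F) := by
  intro i _
  rw [Matrix.mulVec, dotProduct]
  refine (degreeLT R (k + polyMatrixDegree F)).sum_mem fun j _ => mem_degreeLT.2 ?_
  have h1 : (F i j).degree ≤ (polyMatrixDegree F : ℕ) := degree_le_of_natDegree_le <|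
    (Finset.le_sup (f := fun j => (F i j).natDegree) (Finset.mem_univ j)).trans
      (Finset.le_sup (f := fun i => polyVecDegree (F i)) (Finset.mem_univ i))
  have h2 : (y j).degree < (k : ℕ) := mem_degreeLT.1 (hy j trivial)
  calc (F i j * y j).degree ≤ (F i j).degree + (y j).degree := degree_mul_le _ _
    _ ≤ (polyMatrixDegree F : ℕ) + (y j).degree := by gcongr
    _ < (polyMatrixDegree F : ℕ) + (k : ℕ) :=
      WithBot.add_lt_add_left (WithBot.natCast_ne_bot _) h2
    _ = ((k + polyMatrixDegree F : ℕ) : WithBot ℕ) := by push_cast; rw [add_comm]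

end PolyVecLT

/-- A submodule of rank `r` of a free module embeds into at most `r` of the coordinates. -/
theorem exists_finset_coord_injective {R ι : Type*} [CommRing R] [IsDomain R] [Finite ι]
    (N : Submodule R (ι → R)) [Module.Finite R N] :
    ∃ I : Finset ι, I.card ≤ Module.finrank R N ∧ ∀ v ∈ N, (∀ i ∈ I, v i = 0) → v = 0 := by
  classical
  have := Fintype.ofFinite ι
  -- By minimality each `i ∈ I` has a vector of `N` vanishing on `I` except at `i`; these vectors
  -- are independent.
  obtain ⟨I, hI, hmin⟩ := (wellFounded_lt (α := Finset ι)).has_min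
    {I | ∀ v ∈ N, (∀ i ∈ I, v i = 0) → v = 0}
    ⟨Finset.univ, fun v _ h => funext fun i => h i (Finset.mem_univ i)⟩
  refine ⟨I, ?_, hI⟩
  have hex : ∀ i : I, ∃ v ∈ N, (∀ j ∈ I.erase i, v j = 0) ∧ v ≠ 0 := by
    intro i
    by_contra! h
    exact hmin (I.erase i) h (Finset.erase_ssubset i.2)
  choose v hvN hv0 hvne using hex
  have hvi : ∀ i : I, v i i ≠ 0 := by
    intro i hi
    refine hvne i (hI _ (hvN i) fun j hj => ?_)
    by_cases hji : j = i
    · rw [hji, hi]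
    · exact hv0 i j (Finset.mem_erase.2 ⟨hji, hj⟩)
  have hli : LinearIndependent R fun i : I => (⟨v i, hvN i⟩ : N) := by
    rw [Fintype.linearIndependent_iff]
    intro g hg i
    have h := congrArg (fun w : N => (w : ι → R) i) hg
    simp only [Submodule.coe_sum, Submodule.coe_smul, Finset.sum_apply, Pi.smul_apply,
      smul_eq_mul, ZeroMemClass.coe_zero, Pi.zero_apply] at h
    rw [Finset.sum_eq_single i] at h
    · exact (mul_eq_zero.1 h).resolve_right (hvi i)
    · intro j _ hji
      rw [hv0 j i (Finset.mem_erase.2 ⟨fun h => hji (Subtype.ext h.symm), i.2⟩), mul_zero]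
    · simp
  simpa using hli.fintype_card_le_finrank

/-! ### Rank estimates for solutions of bounded degree. -/

section SolLT

variable {R : Type*} [CommRing R] {n m : ℕ}

/-- The solutions of `F y = 0` all of whose entries have degree less than `k`. -/
noncomputable def solLT (F : Matrix (Fin n) (Fin m) R[X]) (k : ℕ) : Submodule R (Fin m → R[X]) :=
  (solModule F).restrictScalars R ⊓ polyVecLT R m k

instance [IsNoetherianRing R] (F : Matrix (Fin n) (Fin m) R[X]) (k : ℕ) :
    Module.Finite R (solLT F k) :=
  Module.Finite.iff_fg.2 <| Submodule.FG.of_le (Module.Finite.iff_fg.1 inferInstance) inf_le_right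

variable (F : Matrix (Fin n) (Fin m) R[X])

theorem solLT_mono (k : ℕ) : solLT F k ≤ solLT F (k + 1) :=
  inf_le_inf_left _ (polyVecLT_mono (Nat.le_succ k))

theorem X_smul_mem_solLT (k : ℕ) (y : Fin m → R[X]) (hy : y ∈ solLT F k) :
    (X : R[X]) • y ∈ solLT F (k + 1) :=
  ⟨(solModule F).smul_mem X hy.1, X_smul_mem_polyVecLT.2 hy.2⟩

variable [IsDomain R]

/-- The image embeds into `F.rank` coordinates, each a polynomial of degree `< k + deg F`. -/
theorem finrank_map_mulVecLin_le (k : ℕ) :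
    Module.finrank R ((polyVecLT R m k).map (F.mulVecLin.restrictScalars R)) ≤
      F.rank * (k + polyMatrixDegree F) := by
  obtain ⟨I, hcard, hI⟩ := exists_finset_coord_injective (LinearMap.range F.mulVecLin)
  let P : ((polyVecLT R m k).map (F.mulVecLin.restrictScalars R)) →ₗ[R]
      (I → degreeLT R (k + polyMatrixDegree F)) :=
    LinearMap.pi fun i => ((LinearMap.proj (i : Fin n)).comp (Submodule.subtype _)).codRestrict _ (by
      rintro ⟨_, y, hy, rfl⟩
      exact mulVec_mem_polyVecLT F hy i trivial)
  have hP : Function.Injective P := by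
    rw [injective_iff_map_eq_zero]
    rintro ⟨_, y, hy, rfl⟩ h
    exact Subtype.ext (hI _ ⟨y, rfl⟩ fun i hi => congrArg Subtype.val (congrFun h ⟨i, hi⟩))
  refine (LinearMap.finrank_le_finrank_of_injective hP).trans ?_
  rw [Module.finrank_pi_fintype]
  simp only [finrank_degreeLT, Finset.sum_const, Finset.card_univ, Fintype.card_coe, smul_eq_mul]
  exact Nat.mul_le_mul_right _ hcard

/-- Lift `F.rank` independent vectors of the range to `u i`; their combinations with coefficients of
degree `< k` have independent images. -/
theorem exists_le_finrank_map_mulVecLin : ∃ C, ∀ k, F.rank * k ≤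
    Module.finrank R ((polyVecLT R m (k + C)).map (F.mulVecLin.restrictScalars R)) := by
  obtain ⟨f, hf⟩ := exists_linearIndependent_of_le_finrank (R := R[X]) (n := F.rank)
    (M := LinearMap.range F.mulVecLin) le_rfl
  choose u hu using fun i => (f i).2
  let C := Finset.univ.sup fun i => polyVecDegree (u i) + 1
  refine ⟨C, fun k => ?_⟩
  have huC : ∀ i, u i ∈ polyVecLT R m C := fun i => mem_polyVecLT_of_polyVecDegree
    (Nat.lt_of_succ_le (Finset.le_sup (f := fun i => polyVecDegree (u i) + 1) (Finset.mem_univ i)))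
  let Q : polyVecLT R F.rank k →ₗ[R] (Fin n → R[X]) :=
    (((F.mulVecLin.comp (Fintype.linearCombination R[X] u)).restrictScalars R).comp
      (Submodule.subtype _))
  have hQ_apply : ∀ c, Q c = F.mulVecLin (∑ i, c.1 i • u i) := fun c =>
    congrArg F.mulVecLin (Fintype.linearCombination_apply _ _ _)
  have hQ : ∀ c, Q c ∈ (polyVecLT R m (k + C)).map (F.mulVecLin.restrictScalars R) := by
    intro c
    refine ⟨∑ i, c.1 i • u i, (polyVecLT R m (k + C)).sum_mem fun i _ =>
      smul_mem_polyVecLT (c.2 i trivial) (huC i), (hQ_apply c).symm⟩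
  have hinj : Function.Injective (Q.codRestrict _ hQ) := by
    rw [injective_iff_map_eq_zero]
    intro c hc
    have hc' : F.mulVecLin (∑ i, c.1 i • u i) = 0  :=
      (hQ_apply c).symm.trans (congrArg Subtype.val hc)
    rw [map_sum] at hc'
    simp only [map_smul, hu] at hc'
    exact Subtype.ext (funext (Fintype.linearIndependent_iff.1 hf c.1
      (Subtype.ext (by simpa using hc'))))
  have := LinearMap.finrank_le_finrank_of_injective hinj
  rwa [finrank_polyVecLT] at this

variable [IsNoetherianRing R]

theorem finrank_solLT_add_finrank_map (k : ℕ) :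
    Module.finrank R (solLT F k) +
      Module.finrank R ((polyVecLT R m k).map (F.mulVecLin.restrictScalars R)) = m * k := by
  set L := F.mulVecLin.restrictScalars R
  have h := LinearMap.rank_range_add_rank_ker (L.domRestrict (polyVecLT R m k))
  have hker : Module.finrank R (LinearMap.ker (L.domRestrict (polyVecLT R m k))) =
      Module.finrank R (solLT F k) := by
    rw [(Submodule.equivSubtypeMap _ _).finrank_eq]
    have heq : (LinearMap.ker (L.domRestrict (polyVecLT R m k))).map (polyVecLT R m k).subtype =
        solLT F k := by
      rw [LinearMap.ker_domRestrict, Submodule.map_comap_subtype, inf_comm]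
      rfl
    rw [heq]
  rw [LinearMap.range_domRestrict] at h
  have hfin : Module.Finite R ((polyVecLT R m k).map L) := inferInstance
  rw [← Module.finrank_eq_rank, ← Module.finrank_eq_rank, ← Module.finrank_eq_rank, hker,
    finrank_polyVecLT] at h
  norm_cast at h
  omega

theorem le_finrank_solLT (k : ℕ) :
    ((m : ℤ) - F.rank) * k - (F.rank * polyMatrixDegree F : ℕ) ≤ Module.finrank R (solLT F k) := by
  have h1 : (_ : ℤ) = _ := congrArg Nat.cast (finrank_solLT_add_finrank_map F k)
  have h2 := finrank_map_mulVecLin_le F k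
  zify at h1 h2 ⊢
  linarith

theorem exists_finrank_solLT_le :
    ∃ C : ℤ, ∀ k : ℕ, Module.finrank R (solLT F k) ≤ ((m : ℤ) - F.rank) * k + C := by
  obtain ⟨C, hC⟩ := exists_le_finrank_map_mulVecLin F
  refine ⟨F.rank * C, fun k => ?_⟩
  have h1 := finrank_solLT_add_finrank_map F k
  rcases le_total C k with hk | hk
  · obtain ⟨k, rfl⟩ : ∃ k', k = k' + C := ⟨k - C, by omega⟩
    have h2 := hC k
    zify at h1 h2 ⊢
    linarith
  · have h2 : F.rank * k ≤ F.rank * C := Nat.mul_le_mul_left _ hk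
    zify at h1 h2 ⊢
    linarith

theorem two_mul_finrank_solLT_le (k : ℕ) :
    2 * (Module.finrank R (solLT F (k + 1)) : ℤ) ≤
      Module.finrank R (solLT F (k + 2)) + Module.finrank R (solLT F k) :=
  two_mul_finrank_le polyVecMulX_injective (solLT_mono F) (X_smul_mem_solLT F)
    (fun _ _ hy hXy => ⟨hy.1, X_smul_mem_polyVecLT.1 hXy.2⟩) k

end SolLT

/-! ### Generation over ℤ. -/

section Integers

variable {n m : ℕ} (F : Matrix (Fin n) (Fin m) ℤ[X])

/-- Reduction of integral polynomial vectors modulo `p`. -/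
noncomputable def polyVecReduction (m p : ℕ) :
    (Fin m → ℤ[X]) →ₛₗ[Int.castRingHom (ZMod p)] (Fin m → (ZMod p)[X]) where
  toFun y j := (y j).map (Int.castRingHom (ZMod p))
  map_add' _ _ := funext fun _ => Polynomial.map_add _
  map_smul' _ _ := funext fun _ => Polynomial.map_smul _ _

theorem polyVecReduction_X_smul (p : ℕ) (y : Fin m → ℤ[X]) :
    polyVecReduction m p ((X : ℤ[X]) • y) = (X : (ZMod p)[X]) • polyVecReduction m p y :=
  funext fun j => by simp [polyVecReduction]

theorem exists_eq_smul_of_polyVecReduction_eq_zero {p : ℕ} {x : Fin m → ℤ[X]}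
    (hx : polyVecReduction m p x = 0) : ∃ z, x = (p : ℤ) • z := by
  have h : ∀ j, C (p : ℤ) ∣ x j := fun j => C_dvd_iff_dvd_coeff _ _ |>.2 fun i => by
    have := congrArg (fun f => coeff f i) (congrFun hx j)
    simpa [polyVecReduction, ZMod.intCast_zmod_eq_zero_iff_dvd] using this
  choose z hz using h
  exact ⟨z, funext fun j => by rw [hz, Pi.smul_apply, smul_eq_C_mul]⟩

theorem mem_solLT_of_smul_mem {p : ℤ} (hp : p ≠ 0) {k : ℕ} {z : Fin m → ℤ[X]}
    (h : p • z ∈ solLT F k) : z ∈ solLT F k := by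
  refine ⟨?_, mem_polyVecLT.2 fun j i hi => ?_⟩
  · have h1 := (mem_solModule F _).1 h.1
    rw [Matrix.mulVec_smul] at h1
    exact (mem_solModule F _).2 ((smul_eq_zero.1 h1).resolve_left hp)
  · have h1 := mem_polyVecLT.1 h.2 j i hi
    rw [Pi.smul_apply, coeff_smul] at h1
    exact (smul_eq_zero.1 h1).resolve_left hp

/-- Beyond degree `rank F * deg F`, solutions are generated by solutions of smaller degree. -/
theorem solLT_le_sup {k : ℕ} (hk : F.rank * polyMatrixDegree F ≤ k) :
    solLT F (k + 2) ≤ solLT F (k + 1) ⊔ (solLT F (k + 1)).map (polyVecMulX ℤ m) := by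
  refine le_of_le_sup_smul_prime fun p hp b hb => ?_
  have : Fact p.Prime := ⟨hp⟩
  have hp0 : (p : ℤ) ≠ 0 := by exact_mod_cast hp.ne_zero
  let V : ℕ → Submodule (ZMod p) (Fin m → (ZMod p)[X]) := fun k =>
    (solLT F k).map (polyVecReduction m p)
  have hrank : ∀ k, Module.finrank (ZMod p) (V k) = Module.finrank ℤ (solLT F k) := fun k =>
    finrank_map_reduction (fun _ => exists_eq_smul_of_polyVecReduction_eq_zero) _
      fun _ => mem_solLT_of_smul_mem F hp0
  obtain ⟨C, hC⟩ := exists_finrank_solLT_le F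
  have hV := le_sup_map_of_finrank (V := V) (U := polyVecLT (ZMod p) m)
    (T := polyVecMulX (ZMod p) m) polyVecMulX_injective
    (fun k => Submodule.map_mono (solLT_mono F k))
    (by
      rintro k _ ⟨y, hy, rfl⟩
      exact ⟨_, X_smul_mem_solLT F k y hy, polyVecReduction_X_smul p y⟩)
    (by
      rintro k _ ⟨y, hy, rfl⟩
      refine mem_polyVecLT.2 fun j i hi => ?_
      simp [polyVecReduction, mem_polyVecLT.1 hy.2 j i hi])
    (fun k w => X_smul_mem_polyVecLT.1) polyVecLT_zero (m := m) (fun k => (finrank_polyVecLT k).le)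
    -- Convexity comes from ℤ through equality of ranks, since `V` itself may fail to be saturated.
    (fun k => by simpa only [hrank] using two_mul_finrank_solLT_le F k)
    (s := (m : ℤ) - F.rank) (C := C) (e := F.rank * polyMatrixDegree F)
    (fun k => by simpa only [hrank] using le_finrank_solLT F k)
    (fun k => by simpa only [hrank] using hC k) hk
  obtain ⟨_, ⟨u, hu, rfl⟩, _, ⟨_, ⟨v, hv, rfl⟩, rfl⟩, huv⟩ := Submodule.mem_sup.1 (hV ⟨b, hb, rfl⟩)
  rw [polyVecMulX_apply, ← polyVecReduction_X_smul, ← map_add] at huv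
  -- The lift differs from `b` by `p • z`, and purity makes `z` a solution of the same degree bound.
  obtain ⟨z, hz⟩ := exists_eq_smul_of_polyVecReduction_eq_zero (p := p)
    (x := b - (u + (X : ℤ[X]) • v)) (by rw [map_sub, huv, sub_self])
  refine ⟨u + (X : ℤ[X]) • v, Submodule.add_mem_sup hu ⟨v, hv, rfl⟩, z, ?_, ?_⟩
  · exact mem_solLT_of_smul_mem F hp0 <| hz ▸
      sub_mem hb (add_mem (solLT_mono F _ hu) (X_smul_mem_solLT F _ v hv))
  · rw [← hz]; abel

theorem span_solLT_eq_solModule :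
    Submodule.span ℤ[X] (solLT F (F.rank * polyMatrixDegree F + 1) : Set (Fin m → ℤ[X])) =
      solModule F := by
  set e := F.rank * polyMatrixDegree F
  set A := Submodule.span ℤ[X] (solLT F (e + 1) : Set (Fin m → ℤ[X]))
  have hle : ∀ j, ∀ y ∈ solLT F (e + j + 1), y ∈ A := by
    intro j
    induction j with
    | zero => exact fun y hy => Submodule.subset_span hy
    | succ j ih =>
      intro y hy
      obtain ⟨u, hu, _, ⟨v, hv, rfl⟩, rfl⟩ :=
        Submodule.mem_sup.1 (solLT_le_sup F (Nat.le_add_right e j) hy)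
      exact add_mem (ih u hu) (Submodule.smul_mem _ _ (ih v hv))
  refine le_antisymm (Submodule.span_le.2 fun y hy => hy.1) fun y hy => ?_
  exact hle (polyVecDegree y) y ⟨hy, mem_polyVecLT_of_polyVecDegree (by omega)⟩

/-- The solution module is generated by finitely many solutions of degree at most
`rank F * deg F`. -/
theorem exists_finset_span_eq_solModule :
    ∃ S : Finset (Fin m → ℤ[X]),
      Submodule.span ℤ[X] (S : Set (Fin m → ℤ[X])) = solModule F ∧
      ∀ y ∈ S, polyVecDegree y ≤ F.rank * polyMatrixDegree F := by
  obtain ⟨S, hS⟩ := Module.Finite.iff_fg.1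
    (inferInstance : Module.Finite ℤ (solLT F (F.rank * polyMatrixDegree F + 1)))
  refine ⟨S, ?_, fun y hy => polyVecDegree_le_of_mem (hS ▸ Submodule.subset_span hy :
    y ∈ solLT F (F.rank * polyMatrixDegree F + 1)).2⟩
  rw [← span_solLT_eq_solModule, ← hS, Submodule.span_span_of_tower]

end Integers

theorem corollary3p7 (n m : ℕ) (F : Matrix (Fin n) (Fin m) ℤ[X]) :
    (∃ S : Finset (Fin m → ℤ[X]),
        Submodule.span ℤ[X] (S : Set (Fin m → ℤ[X])) = solModule F ∧
        ∀ y ∈ S, polyVecDegree y ≤ n * polyMatrixDegree F) ∧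
      ∀ r : ℕ, F.rank = r →
        ∃ S : Finset (Fin m → ℤ[X]),
          Submodule.span ℤ[X] (S : Set (Fin m → ℤ[X])) = solModule F ∧
          ∀ y ∈ S, polyVecDegree y ≤ r * polyMatrixDegree F := by
  refine ⟨?_, fun r hr => hr ▸ exists_finset_span_eq_solModule F⟩
  obtain ⟨S, hS, hdeg⟩ := exists_finset_span_eq_solModule F
  exact ⟨S, hS, fun y hy => (hdeg y hy).trans (Nat.mul_le_mul_right _ F.rank_le_height)⟩
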